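/- Let $SG(n)$, $n\ge 0$, be the stage-$n$ two-dimensional Sierpinski gasket graph: $SG(0)$ is a triangle, and $SG(n+1)$ is obtained by juxtaposing three copies of $SG(n)$ (lower left, lower right, top), any two of which share exactly one outmost vertex. Let $o$, $a_n$, $b_n$ be the leftmost, rightmost and topmost vertices of $SG(n)$. Let $g(n)$ be the number of spanning subgraphs of $SG(n)$ that consist of exactly two trees, one containing $b_n$ and the other containing both $o$ and $a_n$ (an isolated vertex counts as a tree), and let $h(n)$ be the number of spanning subgraphs that consist of exactly three trees, such that $o$, $a_n$, $b_n$ lie in three different trees. For a vertex $x$ and $i\ge 0$ let $g_i(n,x)$ (respectively $h_i(n,x)$) be the number of those spanning subgraphs counted by $g(n)$ (respectively $h(n)$) in which $x$ has degree $i$, and put $G_i(n,x)=g_i(n,x)/g(n)$ and $H_i(n,x)=h_i(n,x)/h(n)$. Then for every integer $n\ge 0$ $$G_0(n,b_n)=\tfrac{33}{28}\left(\tfrac35\right)^n-\tfrac{5}{28}\left(\tfrac1{25}\right)^n,$$ $$H_0(n,o)=\tfrac{11}{14}\left(\tfrac35\right)^n+\tfrac{3}{14}\left(\tfrac1{25}\right)^n,$$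 $$G_1(n,b_n)=\tfrac{11}{14}-\tfrac27\left(\tfrac1{15}\right)^n-\tfrac67\left(\tfrac35\right)^n+\tfrac5{14}\left(\tfrac1{25}\right)^n,$$ $$G_2(n,b_n)=\tfrac{3}{14}+\tfrac27\left(\tfrac1{15}\right)^n-\tfrac9{28}\left(\tfrac35\right)^n-\tfrac5{28}\left(\tfrac1{25}\right)^n,$$ $$H_1(n,o)=\tfrac{11}{14}+\tfrac3{14}\left(\tfrac1{15}\right)^n-\tfrac47\left(\tfrac35\right)^n-\tfrac37\left(\tfrac1{25}\right)^n,$$ $$H_2(n,o)=\tfrac{3}{14}-\tfrac3{14}\left(\tfrac1{15}\right)^n-\tfrac3{14}\left(\tfrac35\right)^n+\tfrac3{14}\left(\tfrac1{25}\right)^n.$$ -/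

import Mathlib

/-!
The two-dimensional Sierpinski gasket `SG(n)`, drawn on the triangular lattice.  The pair
`(i, j)` stands for the lattice point `i • u + j • v`, where `u` points to the right and `v`
to the upper right (at 60 degrees); `SG(n)` has side length `2 ^ n` and its leftmost vertex
is `(0, 0)`.
-/

namespace SierpinskiGasket

/-- Translation of lattice points. -/
def shift (t p : ℕ × ℕ) : ℕ × ℕ := (p.1 + t.1, p.2 + t.2)

/-- Vertices of `SG(n)`: `SG(0)` is a triangle, and `SG(n+1)` consists of three copies of
`SG(n)`, placed at the lower left, the lower right and the top. -/
def verts : ℕ → Finset (ℕ × ℕ)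
  | 0 => {(0, 0), (1, 0), (0, 1)}
  | n + 1 => verts n ∪ (verts n).image (shift (2 ^ n, 0)) ∪ (verts n).image (shift (0, 2 ^ n))

/-- Edges of `SG(n)`, built by the same recursion. -/
def edges : ℕ → Finset (Sym2 (ℕ × ℕ))
  | 0 => {s((0, 0), (1, 0)), s((0, 0), (0, 1)), s((1, 0), (0, 1))}
  | n + 1 => edges n ∪ (edges n).image (Sym2.map (shift (2 ^ n, 0))) ∪
      (edges n).image (Sym2.map (shift (0, 2 ^ n)))

/-- The vertex type of `SG(n)`. -/
abbrev Vert (n : ℕ) : Type := {p : ℕ × ℕ // p ∈ verts n}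

/-- The graph `SG(n)`. -/
def SG (n : ℕ) : SimpleGraph (Vert n) :=
  SimpleGraph.comap Subtype.val
    (SimpleGraph.fromEdgeSet (edges n : Set (Sym2 (ℕ × ℕ))))

theorem origin_mem (n : ℕ) : ((0, 0) : ℕ × ℕ) ∈ verts n := by
  induction n with
  | zero => simp [verts]
  | succ n ih => simp [verts, ih]

theorem right_mem (n : ℕ) : ((2 ^ n, 0) : ℕ × ℕ) ∈ verts n := by
  induction n with
  | zero => simp [verts]
  | succ n ih =>
    refine Finset.mem_union_left _ (Finset.mem_union_right _ (Finset.mem_image.2 ⟨_, ih, ?_⟩))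
    simp only [shift, Prod.mk.injEq]
    exact ⟨by ring, trivial⟩

theorem top_mem (n : ℕ) : ((0, 2 ^ n) : ℕ × ℕ) ∈ verts n := by
  induction n with
  | zero => simp [verts]
  | succ n ih =>
    refine Finset.mem_union_right _ (Finset.mem_image.2 ⟨_, ih, ?_⟩)
    simp only [shift, Prod.mk.injEq]
    exact ⟨trivial, by ring⟩

/-- The leftmost vertex `o` of `SG(n)`. -/
def o (n : ℕ) : Vert n := ⟨(0, 0), origin_mem n⟩

/-- The rightmost vertex `a_n` of `SG(n)`. -/
def a (n : ℕ) : Vert n := ⟨(2 ^ n, 0), right_mem n⟩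

/-- The topmost vertex `b_n` of `SG(n)`. -/
def b (n : ℕ) : Vert n := ⟨(0, 2 ^ n), top_mem n⟩

/-- Spanning subgraphs of `SG(n)` that consist of `k` trees, i.e. acyclic ones with exactly
`k` connected components. -/
def spanningForests (n k : ℕ) : Set (SimpleGraph (Vert n)) :=
  {T | T ≤ SG n ∧ T.IsAcyclic ∧ Nat.card T.ConnectedComponent = k}

/-- Spanning subgraphs with two trees, one containing `b_n` and the other one containing
`o` and `a_n`. -/
def twoTrees (n : ℕ) : Set (SimpleGraph (Vert n)) :=
  {T | T ∈ spanningForests n 2 ∧ T.Reachable (o n) (a n) ∧ ¬ T.Reachable (o n) (b n)}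

/-- Spanning subgraphs with three trees such that `o`, `a_n` and `b_n` belong to three
different trees. -/
def threeTrees (n : ℕ) : Set (SimpleGraph (Vert n)) :=
  {T | T ∈ spanningForests n 3 ∧ ¬ T.Reachable (o n) (a n) ∧ ¬ T.Reachable (o n) (b n) ∧
    ¬ T.Reachable (a n) (b n)}

/-- `g(n)`. -/
noncomputable def g (n : ℕ) : ℕ := (twoTrees n).ncard

/-- `h(n)`. -/
noncomputable def h (n : ℕ) : ℕ := (threeTrees n).ncard

/-- `g_i(n, x)`: those configurations counted by `g(n)` in which `x` has degree `i`. -/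
noncomputable def gDeg (i n : ℕ) (x : Vert n) : ℕ :=
  {T | T ∈ twoTrees n ∧ (T.neighborSet x).ncard = i}.ncard

/-- `h_i(n, x)`: those configurations counted by `h(n)` in which `x` has degree `i`. -/
noncomputable def hDeg (i n : ℕ) (x : Vert n) : ℕ :=
  {T | T ∈ threeTrees n ∧ (T.neighborSet x).ncard = i}.ncard

/-- The probability `G_i(n, x) = g_i(n, x) / g(n)`. -/
noncomputable def G (i n : ℕ) (x : Vert n) : ℝ := (gDeg i n x : ℝ) / (g n : ℝ)

/-- The probability `H_i(n, x) = h_i(n, x) / h(n)`. -/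
noncomputable def H (i n : ℕ) (x : Vert n) : ℝ := (hDeg i n x : ℝ) / (h n : ℝ)

end SierpinskiGasket

/-!
Cut a spanning forest of `SG (n + 1)` whose trees all contain an outmost vertex into its parts in
the three copies of `SG n`. These parts are forests of the same kind, and whether three such forests
fit together depends only on the partitions they induce on their corners: connectivity at the
corners is generated by these partitions, and acyclicity is a matter of counting vertices, edges and
components. The numbers of forests with given corner partitions therefore satisfy a recursion with
fixed coefficients, and so do the numbers with prescribed degree at a corner, because a corner of
`SG (n + 1)` lies in a single copy of `SG n`.

The numbers `τ n` of spanning trees, `g n` and `h n` keep the relation `τ n * h n = 3 * g n ^ 2`, so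
that, up to two scaling factors, the weights in this recursion do not depend on `n`. After division
by the number of forests, the degree at a corner follows a linear recursion with a constant
`4 × 4` matrix, indexed by the ways in which the corner can be connected to the other two. Its
eigenvalues are `1`, `3 / 5`, `1 / 15` and `1 / 25`.
-/

namespace SierpinskiGasket

open SimpleGraph

section Forests

variable {V : Type*} {T : SimpleGraph V}

theorem reachable_sup_edge_cases {x y u v : V} (huv : (T ⊔ edge x y).Reachable u v) :
    T.Reachable u v ∨ T.Reachable u x ∧ T.Reachable y v ∨ T.Reachable u y ∧ T.Reachable x v := by
  rw [reachable_iff_reflTransGen] at huv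
  induction huv with
  | refl => exact Or.inl (Reachable.refl _)
  | tail _ hvw ih =>
    rcases hvw with hvw | hvw
    · exact ih.imp (·.trans hvw.reachable)
        (Or.imp (And.imp_right (·.trans hvw.reachable)) (And.imp_right (·.trans hvw.reachable)))
    · obtain ⟨⟨rfl, rfl⟩ | ⟨rfl, rfl⟩, -⟩ := (edge_adj ..).1 hvw
      · rcases ih with h | ⟨h, -⟩ | ⟨h, -⟩
        · exact Or.inr (Or.inl ⟨h, Reachable.refl _⟩)
        · exact Or.inr (Or.inl ⟨h, Reachable.refl _⟩)
        · exact Or.inl h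
      · rcases ih with h | ⟨h, -⟩ | ⟨h, -⟩
        · exact Or.inr (Or.inr ⟨h, Reachable.refl _⟩)
        · exact Or.inl h
        · exact Or.inr (Or.inr ⟨h, Reachable.refl _⟩)

variable [Finite V]

theorem card_edgeSet_sup_edge {x y : V} (hxy : ¬ T.Reachable x y) :
    Nat.card (T ⊔ edge x y).edgeSet = Nat.card T.edgeSet + 1 := by
  have hne : x ≠ y := fun h => hxy (h ▸ Reachable.refl _)
  have hnotMem : s(x, y) ∉ T.edgeSet := fun h => hxy (Adj.reachable h)
  rw [edgeSet_sup, edgeSet_edge_of_ne hne, Set.union_singleton, Nat.card_coe_set_eq,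
    Nat.card_coe_set_eq, Set.ncard_insert_of_notMem hnotMem]

theorem card_connectedComponent_sup_edge {x y : V} (hxy : ¬ T.Reachable x y) :
    Nat.card (T ⊔ edge x y).ConnectedComponent + 1 = Nat.card T.ConnectedComponent := by
  have hne : x ≠ y := fun h => hxy (h ▸ Reachable.refl _)
  let merge : T.ConnectedComponent → (T ⊔ edge x y).ConnectedComponent :=
    ConnectedComponent.map (Hom.ofLE le_sup_left)
  have hinj : Set.InjOn merge {T.connectedComponentMk y}ᶜ := by
    intro C hC D hD hCD
    obtain ⟨u, rfl⟩ := C.exists_rep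
    obtain ⟨v, rfl⟩ := D.exists_rep
    rcases reachable_sup_edge_cases (ConnectedComponent.exact hCD) with h | ⟨-, h⟩ | ⟨h, -⟩
    · exact ConnectedComponent.sound h
    · exact (hD (ConnectedComponent.sound h.symm)).elim
    · exact (hC (ConnectedComponent.sound h)).elim
  have himage : merge '' {T.connectedComponentMk y}ᶜ = Set.univ := by
    refine Set.eq_univ_of_forall (ConnectedComponent.ind fun v => ?_)
    by_cases hv : T.Reachable v y
    · refine ⟨T.connectedComponentMk x, fun h => hxy (ConnectedComponent.exact h), ?_⟩
      have hadj : (T ⊔ edge x y).Adj x y := Or.inr ((edge_adj ..).2 ⟨Or.inl ⟨rfl, rfl⟩, hne⟩)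
      exact ConnectedComponent.sound (hadj.reachable.trans (hv.mono le_sup_left).symm)
    · exact ⟨T.connectedComponentMk v, fun h => hv (ConnectedComponent.exact h), rfl⟩
  rw [← Set.ncard_univ, ← himage, hinj.ncard_image,
    ← Set.ncard_add_ncard_compl {T.connectedComponentMk y}, Set.ncard_singleton, add_comm]

theorem isAcyclic_iff_card_edgeSet_add_card_connectedComponent :
    T.IsAcyclic ↔ Nat.card T.edgeSet + Nat.card T.ConnectedComponent = Nat.card V := by
  induction hk : Nat.card T.ConnectedComponent generalizing T with
  | zero =>
    have := (Nat.card_eq_zero.1 hk).resolve_right (not_infinite_iff_finite.2 inferInstance)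
    have : IsEmpty V := ⟨fun v => this.elim (T.connectedComponentMk v)⟩
    simp [IsAcyclic.of_subsingleton]
  | succ k ih =>
    by_cases hT : T.Preconnected
    · have : Nonempty T.ConnectedComponent := Finite.card_pos_iff.1 (by omega)
      have hconn : T.Connected :=
        (connected_iff _).2 ⟨hT, this.elim fun C => C.exists_rep.nonempty⟩
      have hone : Nat.card T.ConnectedComponent = 1 :=
        Nat.card_eq_one_iff_unique.2 ⟨hT.subsingleton_connectedComponent, this⟩
      rw [show T.IsAcyclic ↔ T.IsTree by simp [isTree_iff, hconn],
        isTree_iff_connected_and_card, ← hk, hone, and_iff_right hconn]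
    · simp only [Preconnected, not_forall] at hT
      obtain ⟨x, y, hxy⟩ := hT
      rw [← isAcyclic_add_edge_iff_of_not_reachable x y hxy, ih, card_edgeSet_sup_edge hxy,
        add_assoc, add_comm 1]
      have := card_connectedComponent_sup_edge hxy
      omega

end Forests

/-- Several copies of `V`, indexed by `ι` like the marked corners of `V`, that are juxtaposed in
`W`: every vertex of `W` lies in a copy, and two different copies `i` and `j` meet in a single
vertex, which is corner `j` of copy `i` and corner `i` of copy `j`. -/
structure Gluing (ι V W : Type*) where
  corner : ι ↪ V
  copy : ι → V ↪ W
  copy_corner_comm : ∀ i j, copy i (corner j) = copy j (corner i)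
  eq_corner_of_copy_eq : ∀ {i j u v}, i ≠ j → copy i u = copy j v → u = corner j
  exists_copy_eq : ∀ w, ∃ i v, copy i v = w

namespace Gluing

variable {ι V W : Type*} (K : Gluing ι V W)

/-- The corners of the copies. The diagonal element `s(c, c)` stands for the corner of `W` in the
copy `c`; the other elements `s(i, j)` are the vertices shared by two copies. -/
def junction : Sym2 ι → W :=
  Sym2.lift ⟨fun i j => K.copy i (K.corner j), K.copy_corner_comm⟩

theorem exists_corner_of_copy_eq_junction {i : ι} {v : V} {p : Sym2 ι}
    (h : K.copy i v = K.junction p) : ∃ c, v = K.corner c ∧ p = s(i, c) := by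
  induction p with | _ j c
  by_cases hij : i = j
  · subst hij
    exact ⟨c, (K.copy i).injective h, rfl⟩
  · obtain rfl : v = K.corner j := K.eq_corner_of_copy_eq hij h
    rw [K.copy_corner_comm] at h
    obtain rfl : i = c := K.corner.injective ((K.copy j).injective h)
    exact ⟨j, rfl, Sym2.eq_swap⟩

theorem junction_injective : Function.Injective K.junction := by
  intro p q hpq
  induction p with | _ i c
  obtain ⟨d, hd, rfl⟩ := K.exists_corner_of_copy_eq_junction hpq
  obtain rfl : c = d := K.corner.injective hd
  rfl

theorem card_add_sq (K : Gluing ι V W) [Fintype ι] [Finite V] :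
    Nat.card W + Fintype.card ι ^ 2 =
      Fintype.card ι * Nat.card V + (Fintype.card ι + 1).choose 2 := by
  classical
  let interior := {v : V // v ∉ Set.range K.corner}
  let place : Sym2 ι ⊕ ι × interior → W :=
    Sum.elim K.junction fun p => K.copy p.1 p.2
  have hcross (p : Sym2 ι) (i : ι) (v : interior) : K.copy i v ≠ K.junction p := fun h =>
    let ⟨c, hc, _⟩ := K.exists_corner_of_copy_eq_junction h
    v.2 ⟨c, hc.symm⟩
  have hinterior : Function.Injective fun p : ι × interior => K.copy p.1 p.2 := by
    rintro ⟨i, u⟩ ⟨j, v⟩ huv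
    obtain rfl : i = j := by
      by_contra hij
      exact u.2 ⟨j, (K.eq_corner_of_copy_eq hij huv).symm⟩
    exact congrArg (i, ·) (Subtype.ext ((K.copy i).injective huv))
  have hplace : Function.Bijective place := by
    refine ⟨K.junction_injective.sumElim hinterior fun p q h => hcross p q.1 q.2 h.symm,
      fun w => ?_⟩
    obtain ⟨i, v, rfl⟩ := K.exists_copy_eq w
    by_cases hv : v ∈ Set.range K.corner
    · obtain ⟨c, rfl⟩ := hv
      exact ⟨Sum.inl s(i, c), rfl⟩
    · exact ⟨Sum.inr (i, ⟨v, hv⟩), rfl⟩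
  have hcorners : Fintype.card ι + Nat.card interior = Nat.card V := by
    rw [← Nat.card_eq_fintype_card, ← Nat.card_range_of_injective K.corner.injective]
    exact Set.ncard_add_ncard_compl (Set.range K.corner)
  rw [← Nat.card_congr (Equiv.ofBijective place hplace), Nat.card_sum, Nat.card_prod,
    Nat.card_eq_fintype_card, Sym2.card, Nat.card_eq_fintype_card, ← hcorners]
  ring

/-- The union of the graphs `T i`, placed on the copies. -/
def glue (T : ι → SimpleGraph V) : SimpleGraph W := ⨆ i, (T i).map (K.copy i)

variable {K} {T : ι → SimpleGraph V}

theorem glue_adj {x y : W} :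
    (K.glue T).Adj x y ↔ ∃ i u v, (T i).Adj u v ∧ K.copy i u = x ∧ K.copy i v = y := by
  simp only [glue, iSup_adj, SimpleGraph.map_adj]

theorem glue_adj_copy {i : ι} {u v : V} (h : (T i).Adj u v) :
    (K.glue T).Adj (K.copy i u) (K.copy i v) :=
  glue_adj.2 ⟨i, u, v, h, rfl, rfl⟩

theorem comap_copy_glue (T : ι → SimpleGraph V) (i : ι) : (K.glue T).comap (K.copy i) = T i := by
  ext u v
  refine ⟨fun h => ?_, glue_adj_copy⟩
  obtain ⟨j, u', v', h, hu, hv⟩ := glue_adj.1 h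
  by_cases hji : j = i
  · subst hji
    rwa [← (K.copy j).injective hu, ← (K.copy j).injective hv]
  · exact absurd ((K.eq_corner_of_copy_eq hji hu).trans (K.eq_corner_of_copy_eq hji hv).symm) h.ne

theorem glue_comap_copy {S : SimpleGraph W} (hS : S ≤ K.glue T) :
    (K.glue fun i => S.comap (K.copy i)) = S := by
  ext x y
  refine ⟨fun h => ?_, fun h => ?_⟩
  · obtain ⟨i, u, v, huv, rfl, rfl⟩ := glue_adj.1 h
    exact huv
  · obtain ⟨i, u, v, -, rfl, rfl⟩ := glue_adj.1 (hS h)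
    exact glue_adj_copy h

theorem glue_le_glue_iff {S : ι → SimpleGraph V} : K.glue T ≤ K.glue S ↔ ∀ i, T i ≤ S i := by
  refine ⟨fun h i => ?_, fun h => iSup_mono fun i => SimpleGraph.map_monotone _ (h i)⟩
  rw [← comap_copy_glue T i, ← comap_copy_glue S i]
  exact SimpleGraph.comap_monotone _ h

theorem card_edgeSet_glue [Fintype ι] [Finite V] :
    Nat.card (K.glue T).edgeSet = ∑ i, Nat.card (T i).edgeSet := by
  have hdisjoint : Pairwise fun i j =>
      Disjoint ((T i).map (K.copy i)).edgeSet ((T j).map (K.copy j)).edgeSet := by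
    intro i j hij
    rw [disjoint_edgeSet, disjoint_left]
    rintro x y hi hj
    obtain ⟨u, v, huv, rfl, rfl⟩ := (SimpleGraph.map_adj ..).1 hi
    obtain ⟨u', v', -, hu, hv⟩ := (SimpleGraph.map_adj ..).1 hj
    exact huv.ne ((K.eq_corner_of_copy_eq hij hu.symm).trans
      (K.eq_corner_of_copy_eq hij hv.symm).symm)
  rw [glue, edgeSet_iSup, Nat.card_coe_set_eq,
    Set.ncard_iUnion_of_finite (fun i => (edgeSet_map (K.copy i) (T i)) ▸ Set.toFinite _)
      hdisjoint, finsum_eq_sum_of_fintype]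
  refine Finset.sum_congr rfl fun i _ => ?_
  rw [edgeSet_map, Set.ncard_image_of_injective _ (K.copy i).sym2Map.injective,
    Nat.card_coe_set_eq]

theorem neighborSet_glue_junction_diag (c : ι) :
    (K.glue T).neighborSet (K.junction s(c, c)) =
      K.copy c '' (T c).neighborSet (K.corner c) := by
  ext y
  simp only [mem_neighborSet, Set.mem_image]
  refine ⟨fun h => ?_, fun ⟨v, hv, hy⟩ => hy ▸ glue_adj_copy hv⟩
  obtain ⟨i, u, v, huv, hu, rfl⟩ := glue_adj.1 h
  obtain ⟨d, rfl, hd⟩ := K.exists_corner_of_copy_eq_junction hu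
  obtain ⟨rfl, rfl⟩ : c = i ∧ c = d := by simpa [and_comm] using hd
  exact ⟨v, huv, rfl⟩

end Gluing

section RootedForests

variable {ι V : Type*}

/-- The partition of the indices of a family of vertices into the classes of vertices that lie in
the same component of `T`. -/
def cornerPartition (T : SimpleGraph V) (corner : ι → V) : Setoid ι :=
  T.reachableSetoid.comap corner

/-- Every component of `T` contains one of the vertices `corner c`. -/
def RootedAt (T : SimpleGraph V) (corner : ι → V) : Prop := ∀ v, ∃ c, T.Reachable v (corner c)

/-- The spanning forests of `H` in which every tree contains a corner, and whose trees induce the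
partition `r` of the corners. -/
def rootedForests (H : SimpleGraph V) (corner : ι → V) (r : Setoid ι) : Set (SimpleGraph V) :=
  {T | T ≤ H ∧ T.IsAcyclic ∧ RootedAt T corner ∧ cornerPartition T corner = r}

variable {T H : SimpleGraph V} {corner : ι → V}

theorem cornerPartition_apply {c d : ι} :
    cornerPartition T corner c d ↔ T.Reachable (corner c) (corner d) :=
  Iff.rfl

variable [Finite V]

theorem card_connectedComponent_eq_card_cornerPartition_iff :
    Nat.card T.ConnectedComponent = Nat.card (Quotient (cornerPartition T corner)) ↔
      RootedAt T corner := by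
  rw [cornerPartition, Nat.card_congr (Setoid.comapQuotientEquiv corner T.reachableSetoid), eq_comm]
  have hrange : Nat.card (Set.range (T.connectedComponentMk ∘ corner)) =
      Nat.card T.ConnectedComponent ↔ Set.range (T.connectedComponentMk ∘ corner) = Set.univ :=
    (Set.eq_univ_iff_ncard _).symm
  refine hrange.trans (Set.range_eq_univ.trans ⟨fun h v => ?_, fun h C => ?_⟩)
  · obtain ⟨c, hc⟩ := h (T.connectedComponentMk v)
    exact ⟨c, (ConnectedComponent.exact hc).symm⟩
  · obtain ⟨v, rfl⟩ := C.exists_rep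
    obtain ⟨c, hc⟩ := h v
    exact ⟨c, ConnectedComponent.sound hc.symm⟩

theorem RootedAt.isAcyclic_iff (hT : RootedAt T corner) :
    T.IsAcyclic ↔
      Nat.card T.edgeSet + Nat.card (Quotient (cornerPartition T corner)) = Nat.card V := by
  rw [isAcyclic_iff_card_edgeSet_add_card_connectedComponent,
    card_connectedComponent_eq_card_cornerPartition_iff.2 hT]

theorem mem_rootedForests_iff_card_connectedComponent {r : Setoid ι} :
    T ∈ rootedForests H corner r ↔ (T ≤ H ∧ T.IsAcyclic ∧
      Nat.card T.ConnectedComponent = Nat.card (Quotient r)) ∧ cornerPartition T corner = r := by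
  simp only [rootedForests, Set.mem_ofPred_eq, and_assoc]
  refine and_congr_right fun _ => and_congr_right fun _ => and_congr_left fun hr => ?_
  rw [← hr, card_connectedComponent_eq_card_cornerPartition_iff]

end RootedForests

section Link

variable {ι : Type*}

/-- The partition of the corners of the copies that arises when, for every `i`, the corners of
copy `i` are identified according to `r i`. The pair `s(i, c)` stands for corner `c` of copy `i`,
as in `Gluing.junction`. -/
def link (r : ι → Setoid ι) : Setoid (Sym2 ι) := ⨆ i, (r i).map fun c => s(i, c)

theorem link_le_iff {r : ι → Setoid ι} {s : Setoid (Sym2 ι)} :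
    link r ≤ s ↔ ∀ i c d, r i c d → s s(i, c) s(i, d) := by
  refine iSup_le_iff.trans (forall_congr' fun i => ⟨fun h c d hcd => ?_, fun h => ?_⟩)
  · exact h (Setoid.le_comap_map hcd)
  · exact Setoid.eqvGen_le fun _ _ ⟨c, d, hcd, hc, hd⟩ => hc ▸ hd ▸ h c d hcd

theorem link_mk_mk {r : ι → Setoid ι} {i c d : ι} (h : r i c d) : link r s(i, c) s(i, d) :=
  link_le_iff.1 le_rfl i c d h

/-- The condition under which forests inducing the corner partitions `r i` on the copies of a gluing
form a forest on the whole that is rooted at the outer corners and induces `r'` on them. The first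
clause is acyclicity, expressed by a count of components. -/
def Glues [Fintype ι] (r : ι → Setoid ι) (r' : Setoid ι) : Prop :=
  ∑ i, Nat.card (Quotient (r i)) = Nat.card (Quotient r') + (Fintype.card ι).choose 2 ∧
    (link r).comap Sym2.diag = r' ∧ ∀ p, ∃ c, link r p s(c, c)

end Link

theorem sq_eq_choose_two_add_choose_two (k : ℕ) : k ^ 2 = k.choose 2 + (k + 1).choose 2 := by
  induction k with
  | zero => rfl
  | succ k ih =>
    rw [Nat.choose_succ_succ' (k + 1), Nat.choose_one_right, add_sq, ih, Nat.choose_succ_succ' k,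
      Nat.choose_one_right]
    ring

namespace Gluing

variable {ι V W : Type*} {K : Gluing ι V W} {T : ι → SimpleGraph V}

theorem reachable_copy {i : ι} {u v : V} (h : (T i).Reachable u v) :
    (K.glue T).Reachable (K.copy i u) (K.copy i v) :=
  h.map ⟨K.copy i, glue_adj_copy⟩

theorem reachable_junction_of_link {p q : Sym2 ι}
    (h : link (fun i => cornerPartition (T i) K.corner) p q) :
    (K.glue T).Reachable (K.junction p) (K.junction q) :=
  link_le_iff (s := (K.glue T).reachableSetoid.comap K.junction).2
    (fun _ _ _ hcd => reachable_copy (cornerPartition_apply.1 hcd)) h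

theorem exists_link_of_reachable_junction {p : Sym2 ι} {w : W}
    (h : (K.glue T).Reachable (K.junction p) w) :
    ∃ i c v, w = K.copy i v ∧ (T i).Reachable (K.corner c) v ∧
      link (fun i => cornerPartition (T i) K.corner) p s(i, c) := by
  rw [reachable_iff_reflTransGen] at h
  induction h with
  | refl =>
    induction p with | _ i c
    exact ⟨i, c, _, rfl, Reachable.refl _, Setoid.refl' _ _⟩
  | tail _ hxy ih =>
    obtain ⟨i, c, u, rfl, hu, hp⟩ := ih
    obtain ⟨j, u', v, huv, hu', rfl⟩ := glue_adj.1 hxy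
    by_cases hij : i = j
    · subst hij
      obtain rfl := (K.copy i).injective hu'
      exact ⟨i, c, v, rfl, hu.trans huv.reachable, hp⟩
    · obtain rfl := K.eq_corner_of_copy_eq hij hu'.symm
      obtain rfl := K.eq_corner_of_copy_eq (Ne.symm hij) hu'
      refine ⟨j, i, v, rfl, huv.reachable, ?_⟩
      rw [Sym2.eq_swap]
      exact Setoid.trans' _ hp (link_mk_mk hu)

theorem reachable_junction_iff_link {p q : Sym2 ι} :
    (K.glue T).Reachable (K.junction p) (K.junction q) ↔
      link (fun i => cornerPartition (T i) K.corner) p q := by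
  refine ⟨fun h => ?_, reachable_junction_of_link⟩
  obtain ⟨i, c, v, hv, hcv, hp⟩ := exists_link_of_reachable_junction h
  obtain ⟨d, rfl, rfl⟩ := K.exists_corner_of_copy_eq_junction hv.symm
  exact Setoid.trans' _ hp (link_mk_mk hcv)

theorem cornerPartition_glue :
    cornerPartition (K.glue T) (K.junction ∘ Sym2.diag) =
      (link fun i => cornerPartition (T i) K.corner).comap Sym2.diag :=
  Setoid.ext fun _ _ => reachable_junction_iff_link

theorem rootedAt_glue_iff :
    RootedAt (K.glue T) (K.junction ∘ Sym2.diag) ↔ (∀ i, RootedAt (T i) K.corner) ∧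
      ∀ p, ∃ c, link (fun i => cornerPartition (T i) K.corner) p s(c, c) := by
  refine ⟨fun h => ⟨fun i v => ?_, fun p => ?_⟩, fun ⟨hT, hlink⟩ w => ?_⟩
  · obtain ⟨c, hc⟩ := h (K.copy i v)
    obtain ⟨j, d, u, hu, hdu, -⟩ := exists_link_of_reachable_junction hc.symm
    by_cases hij : i = j
    · subst hij
      exact ⟨d, (K.copy i).injective hu ▸ hdu.symm⟩
    · exact ⟨j, K.eq_corner_of_copy_eq hij hu ▸ Reachable.refl _⟩
  · obtain ⟨c, hc⟩ := h (K.junction p)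
    exact ⟨c, reachable_junction_iff_link.1 hc⟩
  · obtain ⟨i, v, rfl⟩ := K.exists_copy_eq w
    obtain ⟨d, hd⟩ := hT i v
    obtain ⟨c, hc⟩ := hlink s(i, d)
    exact ⟨c, (reachable_copy hd).trans (reachable_junction_of_link hc)⟩

variable [Fintype ι] [Finite V]

theorem isAcyclic_glue_iff (hT : ∀ i, RootedAt (T i) K.corner)
    (hglue : RootedAt (K.glue T) (K.junction ∘ Sym2.diag)) :
    (K.glue T).IsAcyclic ↔ (∀ i, (T i).IsAcyclic) ∧
      ∑ i, Nat.card (Quotient (cornerPartition (T i) K.corner)) =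
        Nat.card (Quotient (cornerPartition (K.glue T) (K.junction ∘ Sym2.diag))) +
          (Fintype.card ι).choose 2 := by
  have : Finite W := Finite.of_surjective (fun p : ι × V => K.copy p.1 p.2) fun w =>
    let ⟨i, v, h⟩ := K.exists_copy_eq w
    ⟨(i, v), h⟩
  have hpart (h : (K.glue T).IsAcyclic) (i : ι) : (T i).IsAcyclic :=
    comap_copy_glue (K := K) T i ▸ h.of_comap (K.copy i)
  rw [← and_iff_right_of_imp hpart]
  refine and_congr_right fun hacyclic => ?_
  have hedges : ∑ i, Nat.card (T i).edgeSet +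
      ∑ i, Nat.card (Quotient (cornerPartition (T i) K.corner)) = Fintype.card ι * Nat.card V := by
    rw [← Finset.sum_add_distrib,
      Finset.sum_congr rfl fun i _ => (hT i).isAcyclic_iff.1 (hacyclic i)]
    simp
  have := K.card_add_sq
  have := sq_eq_choose_two_add_choose_two (Fintype.card ι)
  rw [hglue.isAcyclic_iff, card_edgeSet_glue]
  omega

theorem glue_mem_rootedForests_iff {H : SimpleGraph V} {r : Setoid ι} :
    K.glue T ∈ rootedForests (K.glue fun _ => H) (K.junction ∘ Sym2.diag) r ↔
      (∀ i, T i ∈ rootedForests H K.corner (cornerPartition (T i) K.corner)) ∧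
        Glues (fun i => cornerPartition (T i) K.corner) r := by
  simp only [rootedForests, Set.mem_ofPred_eq, glue_le_glue_iff, and_true, forall_and]
  constructor
  · rintro ⟨hle, hacyclic, hrooted, rfl⟩
    obtain ⟨hT, hlink⟩ := rootedAt_glue_iff.1 hrooted
    obtain ⟨hTacyclic, hcard⟩ := (isAcyclic_glue_iff hT hrooted).1 hacyclic
    exact ⟨⟨hle, hTacyclic, hT⟩, hcard, cornerPartition_glue.symm, hlink⟩
  · rintro ⟨⟨hle, hTacyclic, hT⟩, hcard, rfl, hlink⟩
    have hrooted := rootedAt_glue_iff.2 ⟨hT, hlink⟩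
    refine ⟨hle, (isAcyclic_glue_iff hT hrooted).2 ⟨hTacyclic, ?_⟩, hrooted, cornerPartition_glue⟩
    rwa [cornerPartition_glue]

end Gluing

section Labeling

/-- Partitions of `Fin k`, encoded by the function that maps every element to the least element of
its block. -/
abbrev Labeling (k : ℕ) : Type := {f : Fin k → Fin k // ∀ c, f c ≤ c ∧ f (f c) = f c}

namespace Labeling

variable {k : ℕ}

/-- The partition encoded by a labeling. -/
def partition (f : Labeling k) : Setoid (Fin k) := Setoid.ker f.1

theorem partition_apply {f : Labeling k} {c d : Fin k} : f.partition c d ↔ f.1 c = f.1 d := Iff.rfl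

/-- The number of blocks. -/
def blocks (f : Labeling k) : ℕ := (Finset.univ.image f.1).card

theorem card_quotient_partition (f : Labeling k) : Nat.card (Quotient f.partition) = f.blocks := by
  rw [partition, Nat.card_congr (Setoid.quotientKerEquivRange f.1), blocks,
    ← Set.ncard_coe_finset, Finset.coe_image, Finset.coe_univ, Set.image_univ,
    Nat.card_coe_set_eq]

theorem partition_injective : Function.Injective (partition (k := k)) := by
  have hle {f g : Labeling k} (h : f.partition = g.partition) (c : Fin k) : f.1 c ≤ g.1 c := by
    have hfg : f.1 (g.1 c) = f.1 c := (Setoid.ext_iff.1 h _ _).2 (g.2 c).2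
    exact hfg ▸ (f.2 (g.1 c)).1
  exact fun f g h => Subtype.ext (funext fun c => le_antisymm (hle h c) (hle h.symm c))

theorem partition_surjective : Function.Surjective (partition (k := k)) := by
  classical
  intro r
  have hne (c : Fin k) : (Finset.univ.filter (r c)).Nonempty := ⟨c, by simp⟩
  let f (c : Fin k) : Fin k := (Finset.univ.filter (r c)).min' (hne c)
  have hf (c : Fin k) : r c (f c) := (Finset.mem_filter.1 (Finset.min'_mem _ (hne c))).2
  have hcongr {c d : Fin k} (h : r c d) : f c = f d := by
    have : Finset.univ.filter (r c) = Finset.univ.filter (r d) := by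
      ext e
      simpa using ⟨r.trans' (r.symm' h), r.trans' h⟩
    simp only [f, this]
  refine ⟨⟨f, fun c => ⟨Finset.min'_le _ _ (by simp), (hcongr (hf c)).symm⟩⟩, ?_⟩
  refine Setoid.ext fun c d => ⟨fun h => ?_, hcongr⟩
  have h : f c = f d := h
  exact r.trans' (hf c) (h ▸ r.symm' (hf d))

end Labeling

end Labeling

section UnionFind

variable {X : Type*} [DecidableEq X]

/-- Union–find: a map whose fibres are the classes of the equivalence relation generated by the
listed pairs. -/
def mergeAll : List (X × X) → X → X
  | [] => id
  | (x, y) :: l => fun z => if mergeAll l z = mergeAll l x then mergeAll l y else mergeAll l z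

theorem ker_mergeAll (l : List (X × X)) :
    Setoid.ker (mergeAll l) = Relation.EqvGen.setoid fun x y => (x, y) ∈ l := by
  induction l with
  | nil =>
    refine le_antisymm (fun x y h => ?_) (Setoid.eqvGen_le fun x y h => absurd h (by simp))
    obtain rfl : x = y := h
    exact Setoid.refl' _ _
  | cons p l ih =>
    obtain ⟨x, y⟩ := p
    set r := Relation.EqvGen.setoid fun a b => (a, b) ∈ (x, y) :: l with hr
    have hxy : r x y := Relation.EqvGen.rel _ _ (by simp)
    have htail {a b : X} (h : mergeAll l a = mergeAll l b) : r a b := by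
      have hl : Setoid.ker (mergeAll l) ≤ r :=
        ih ▸ Setoid.eqvGen_mono fun a b h => List.mem_cons_of_mem _ h
      exact hl h
    have hrep (a : X) : ∃ a', r a a' ∧ mergeAll ((x, y) :: l) a = mergeAll l a' := by
      by_cases ha : mergeAll l a = mergeAll l x
      · exact ⟨y, r.trans' (htail ha) hxy, by simp [mergeAll, ha]⟩
      · exact ⟨a, r.refl' a, by simp [mergeAll, ha]⟩
    refine le_antisymm (fun a b h => ?_) (Setoid.eqvGen_le fun a b h => ?_)
    · obtain ⟨a', ha, ha'⟩ := hrep a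
      obtain ⟨b', hb, hb'⟩ := hrep b
      have h : mergeAll ((x, y) :: l) a = mergeAll ((x, y) :: l) b := h
      exact r.trans' ha (r.trans' (htail (ha'.symm.trans (h.trans hb'))) (r.symm' hb))
    · rw [Setoid.ker_def]
      rcases List.mem_cons.1 h with h | h
      · obtain ⟨rfl, rfl⟩ := Prod.mk.inj h
        simp [mergeAll]
      · have hab : mergeAll l a = mergeAll l b := by
          rw [← Setoid.ker_def, ih]
          exact Relation.EqvGen.rel _ _ h
        simp only [mergeAll, hab]

end UnionFind

namespace Labeling

variable {k : ℕ}

/-- Pairs `(s(i, c), s(i, d))` that generate `link` for the partitions `f i`. -/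
def linkPairs (f : Fin k → Labeling k) : List (Sym2 (Fin k) × Sym2 (Fin k)) :=
  (List.finRange k).flatMap fun i =>
    ((List.finRange k).filter fun c => (f i).1 c ≠ c).map fun c => (s(i, c), s(i, (f i).1 c))

theorem mem_linkPairs {f : Fin k → Labeling k} {p q : Sym2 (Fin k)} :
    (p, q) ∈ linkPairs f ↔ ∃ i c, (f i).1 c ≠ c ∧ s(i, c) = p ∧ s(i, (f i).1 c) = q := by
  simp [linkPairs]

theorem link_partition (f : Fin k → Labeling k) :
    link (fun i => (f i).partition) = Setoid.ker (mergeAll (linkPairs f)) := by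
  rw [ker_mergeAll]
  refine le_antisymm (link_le_iff.2 fun i c d hcd => ?_) (Setoid.eqvGen_le fun p q hpq => ?_)
  · set r := Relation.EqvGen.setoid fun p q => (p, q) ∈ linkPairs f
    have hlabel (c : Fin k) : r s(i, c) s(i, (f i).1 c) := by
      by_cases hc : (f i).1 c = c
      · rw [hc]
      · exact Relation.EqvGen.rel _ _ (mem_linkPairs.2 ⟨i, c, hc, rfl, rfl⟩)
    have hcd : (f i).1 c = (f i).1 d := hcd
    exact r.trans' (hlabel c) (hcd ▸ r.symm' (hlabel d))
  · obtain ⟨i, c, -, rfl, rfl⟩ := mem_linkPairs.1 hpq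
    exact link_mk_mk ((f i).2 c).2.symm

theorem glues_iff {f : Fin k → Labeling k} {f' : Labeling k} :
    Glues (fun i => (f i).partition) f'.partition ↔
      ∑ i, (f i).blocks = f'.blocks + k.choose 2 ∧
      (∀ c d, mergeAll (linkPairs f) s(c, c) = mergeAll (linkPairs f) s(d, d) ↔
        f'.1 c = f'.1 d) ∧
      ∀ p, ∃ c, mergeAll (linkPairs f) p = mergeAll (linkPairs f) s(c, c) := by
  have hcomap : (link fun i => (f i).partition).comap Sym2.diag = f'.partition ↔
      ∀ c d, mergeAll (linkPairs f) s(c, c) = mergeAll (linkPairs f) s(d, d) ↔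
        f'.1 c = f'.1 d := by
    rw [link_partition, Setoid.ext_iff]
    rfl
  have hlink (p q : Sym2 (Fin k)) : link (fun i => (f i).partition) p q ↔
      mergeAll (linkPairs f) p = mergeAll (linkPairs f) q := by
    rw [link_partition, Setoid.ker_def]
  simp only [Glues, hcomap, hlink, card_quotient_partition, Fintype.card_fin]

instance (f : Fin k → Labeling k) (f' : Labeling k) :
    Decidable (Glues (fun i => (f i).partition) f'.partition) :=
  decidable_of_iff' _ glues_iff

end Labeling

theorem ncard_univ_pi {ι : Type*} {X : ι → Type*} [Fintype ι] (s : ∀ i, Set (X i)) :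
    (Set.univ.pi s).ncard = ∏ i, (s i).ncard := by
  rw [← Nat.card_coe_set_eq, Nat.card_congr (Equiv.Set.univPi s), Nat.card_pi]
  rfl

namespace Gluing

variable {k : ℕ} {V W : Type*} {K : Gluing (Fin k) V W} {H : SimpleGraph V}
  {P : Fin k → SimpleGraph V → Prop} {f' : Labeling k}

theorem glue_injective {ι : Type*} {K : Gluing ι V W} : Function.Injective K.glue := fun S T h =>
  funext fun i => by rw [← comap_copy_glue (K := K) S i, h, comap_copy_glue]

variable [Finite V]

theorem setOf_rootedForests_glue_eq_image :
    {S ∈ rootedForests (K.glue fun _ => H) (K.junction ∘ Sym2.diag) f'.partition |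
        ∀ i, P i (S.comap (K.copy i))} =
      K.glue '' ⋃ f ∈ {f : Fin k → Labeling k | Glues (fun i => (f i).partition) f'.partition},
        Set.univ.pi fun i => {T ∈ rootedForests H K.corner (f i).partition | P i T} := by
  ext S
  simp only [Set.mem_image, Set.mem_iUnion, Set.mem_univ_pi, Set.mem_ofPred_eq, exists_prop]
  constructor
  · rintro ⟨hS, hP⟩
    have hglue := glue_comap_copy hS.1
    rw [← hglue, glue_mem_rootedForests_iff] at hS
    choose f hf using fun i =>
      Labeling.partition_surjective (cornerPartition (S.comap (K.copy i)) K.corner)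
    simp only [← hf] at hS
    exact ⟨_, ⟨f, hS.2, fun i => ⟨hS.1 i, hP i⟩⟩, hglue⟩
  · rintro ⟨T, ⟨f, hf, hT⟩, rfl⟩
    have hpartition (i : Fin k) : cornerPartition (T i) K.corner = (f i).partition :=
      (hT i).1.2.2.2
    refine ⟨glue_mem_rootedForests_iff.2 ?_,
      fun i => (comap_copy_glue (K := K) T i).symm ▸ (hT i).2⟩
    simp only [hpartition]
    exact ⟨fun i => (hT i).1, hf⟩

theorem ncard_rootedForests_glue :
    {S ∈ rootedForests (K.glue fun _ => H) (K.junction ∘ Sym2.diag) f'.partition |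
        ∀ i, P i (S.comap (K.copy i))}.ncard =
      ∑ f : Fin k → Labeling k with Glues (fun i => (f i).partition) f'.partition,
        ∏ i, {T ∈ rootedForests H K.corner (f i).partition | P i T}.ncard := by
  let part (f : Fin k → Labeling k) : Set (Fin k → SimpleGraph V) :=
    Set.univ.pi fun i => {T ∈ rootedForests H K.corner (f i).partition | P i T}
  have hdisjoint : Pairwise fun f₁ f₂ => Disjoint (part f₁) (part f₂) := fun f₁ f₂ hne =>
    Set.disjoint_left.2 fun T h₁ h₂ => hne <| funext fun i =>
      Labeling.partition_injective ((h₁ i trivial).1.2.2.2.symm.trans (h₂ i trivial).1.2.2.2)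
  rw [setOf_rootedForests_glue_eq_image, Set.ncard_image_of_injective _ glue_injective,
    (Set.toFinite _).ncard_biUnion (fun f _ => Set.toFinite _) (hdisjoint.set_pairwise _),
    finsum_mem_eq_toFinset_sum, Set.toFinset_ofPred]
  exact Finset.sum_congr rfl fun f _ => ncard_univ_pi _

end Gluing

section Counts

variable {k : ℕ} {V W : Type*}

/-- The number of rooted forests of `H` that induce the partition encoded by `f` on the corners. -/
noncomputable def forestCount (H : SimpleGraph V) (corner : Fin k → V) (f : Labeling k) : ℕ :=
  (rootedForests H corner f.partition).ncard

/-- The number of those forests counted by `forestCount H corner f` in which the corner `c` has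
degree `d`. -/
noncomputable def degreeCount (H : SimpleGraph V) (corner : Fin k → V) (f : Labeling k) (c : Fin k)
    (d : ℕ) : ℕ :=
  {T ∈ rootedForests H corner f.partition | (T.neighborSet (corner c)).ncard = d}.ncard

variable [Finite V] {H : SimpleGraph V} {f' : Labeling k}

theorem forestCount_glue (K : Gluing (Fin k) V W) :
    forestCount (K.glue fun _ => H) (K.junction ∘ Sym2.diag) f' =
      ∑ f : Fin k → Labeling k with Glues (fun i => (f i).partition) f'.partition,
        ∏ i, forestCount H K.corner (f i) := by
  simpa [forestCount] using Gluing.ncard_rootedForests_glue (K := K) (H := H)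
    (P := fun _ _ => True) (f' := f')

theorem degreeCount_glue (K : Gluing (Fin k) V W) (c : Fin k) (d : ℕ) :
    degreeCount (K.glue fun _ => H) (K.junction ∘ Sym2.diag) f' c d =
      ∑ f : Fin k → Labeling k with Glues (fun i => (f i).partition) f'.partition,
        ∏ i, if i = c then degreeCount H K.corner (f i) c d else forestCount H K.corner (f i) := by
  have hdegree : {S ∈ rootedForests (K.glue fun _ => H) (K.junction ∘ Sym2.diag) f'.partition |
      (S.neighborSet (K.junction s(c, c))).ncard = d} =
      {S ∈ rootedForests (K.glue fun _ => H) (K.junction ∘ Sym2.diag) f'.partition |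
        ∀ i, i = c → ((S.comap (K.copy i)).neighborSet (K.corner c)).ncard = d} := by
    ext S
    refine and_congr_right fun hS => ?_
    rw [forall_eq, ← Gluing.glue_comap_copy hS.1, Gluing.neighborSet_glue_junction_diag,
      Set.ncard_image_of_injective _ (K.copy c).injective, Gluing.comap_copy_glue]
  have hcount := Gluing.ncard_rootedForests_glue (K := K) (H := H) (f' := f')
    (P := fun i T => i = c → (T.neighborSet (K.corner c)).ncard = d)
  refine (congrArg Set.ncard hdegree).trans (hcount.trans (Finset.sum_congr rfl fun f _ =>
    Finset.prod_congr rfl fun i _ => ?_))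
  split_ifs with hi <;> simp [hi, degreeCount, forestCount]

end Counts

section CompleteGraph

theorem comap_mem_rootedForests_iff {ι U V : Type*} {H T : SimpleGraph V} {corner : ι → U}
    {r : Setoid ι} (e : U ≃ V) :
    T.comap e ∈ rootedForests (H.comap e) corner r ↔ T ∈ rootedForests H (e ∘ corner) r := by
  have hreachable {u v : U} : (T.comap e).Reachable u v ↔ T.Reachable (e u) (e v) :=
    (Iso.reachable_iff (φ := Iso.comap e T)).symm
  have hle : T.comap e ≤ H.comap e ↔ T ≤ H :=
    ⟨fun h u v huv => by simpa using @h (e.symm u) (e.symm v) (by simpa using huv),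
      fun h _ _ huv => h huv⟩
  have hrooted : RootedAt (T.comap e) corner ↔ RootedAt T (e ∘ corner) :=
    e.forall_congr fun u => exists_congr fun c => hreachable
  have hpartition : cornerPartition (T.comap e) corner = cornerPartition T (e ∘ corner) :=
    Setoid.ext fun c d => hreachable
  simp only [rootedForests, Set.mem_ofPred_eq, hle, hrooted, hpartition,
    (Iso.comap e T).isAcyclic_iff]

variable {k : ℕ} {E : Finset (Sym2 (Fin k))}

/-- The pairs of vertices of `Fin k` that form an edge in `E`. -/
def adjacentPairs (E : Finset (Sym2 (Fin k))) : List (Fin k × Fin k) :=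
  (List.finRange k ×ˢ List.finRange k).filter fun p => s(p.1, p.2) ∈ E

theorem reachableSetoid_fromEdgeSet :
    (fromEdgeSet (E : Set (Sym2 (Fin k)))).reachableSetoid =
      Setoid.ker (mergeAll (adjacentPairs E)) := by
  have hmem (c d : Fin k) : (c, d) ∈ adjacentPairs E ↔ s(c, d) ∈ E := by simp [adjacentPairs]
  simp only [ker_mergeAll, hmem]
  refine le_antisymm (fun c d hcd => ?_) (Setoid.eqvGen_le fun c d hcd => ?_)
  · refine Relation.EqvGen.mono ?_ _ _
      (Relation.EqvGen.reflTransGen_le_eqvGen _ _ _ ((reachable_iff_reflTransGen ..).1 hcd))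
    exact fun c d hcd => ((fromEdgeSet_adj _).1 hcd).1
  · by_cases h : c = d
    · exact h ▸ Setoid.refl' _ _
    · exact ((fromEdgeSet_adj _).2 ⟨hcd, h⟩).reachable

/-- The edge sets of the forests on `Fin k` whose components form the partition `f`: a graph whose
components form this partition is acyclic if and only if it has `k - f.blocks` edges. -/
def forestEdgeSets (f : Labeling k) : Finset (Finset (Sym2 (Fin k))) :=
  {E ∈ (⊤ : SimpleGraph (Fin k)).edgeFinset.powerset | E.card + f.blocks = k ∧
    ∀ c d, mergeAll (adjacentPairs E) c = mergeAll (adjacentPairs E) d ↔ f.1 c = f.1 d}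

theorem subset_of_mem_forestEdgeSets {f : Labeling k} (hE : E ∈ forestEdgeSets f) :
    E ⊆ (⊤ : SimpleGraph (Fin k)).edgeFinset :=
  Finset.mem_powerset.1 (Finset.mem_filter.1 hE).1

theorem edgeSet_fromEdgeSet_of_subset (hE : E ⊆ (⊤ : SimpleGraph (Fin k)).edgeFinset) :
    (fromEdgeSet (E : Set (Sym2 (Fin k)))).edgeSet = E := by
  rw [edgeSet_fromEdgeSet, sdiff_eq_left, Set.disjoint_left]
  exact fun e he => not_isDiag_of_mem_edgeFinset (hE he)

theorem fromEdgeSet_mem_rootedForests_iff {f : Labeling k}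
    (hE : E ⊆ (⊤ : SimpleGraph (Fin k)).edgeFinset) :
    fromEdgeSet (E : Set (Sym2 (Fin k))) ∈ rootedForests ⊤ id f.partition ↔
      E ∈ forestEdgeSets f := by
  have hrooted : RootedAt (fromEdgeSet (E : Set (Sym2 (Fin k)))) id :=
    fun v => ⟨v, Reachable.refl _⟩
  have hpartition : cornerPartition (fromEdgeSet (E : Set (Sym2 (Fin k)))) id = f.partition ↔
      ∀ c d, mergeAll (adjacentPairs E) c = mergeAll (adjacentPairs E) d ↔ f.1 c = f.1 d := by
    rw [cornerPartition, reachableSetoid_fromEdgeSet]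
    exact Setoid.ext_iff
  rw [rootedForests, Set.mem_ofPred_eq, and_iff_right le_top, and_iff_right hrooted,
    hrooted.isAcyclic_iff, edgeSet_fromEdgeSet_of_subset hE, forestEdgeSets, Finset.mem_filter,
    Finset.mem_powerset, and_iff_right hE, ← hpartition]
  refine and_congr_left fun h => ?_
  simp [h, Labeling.card_quotient_partition]

variable {V : Type*} {corner : Fin k ≃ V} {f : Labeling k}

/-- The graph on `V` whose edges join the vertices `corner c` and `corner d` with `s(c, d) ∈ E`. -/
def cornerGraph (corner : Fin k ≃ V) (E : Finset (Sym2 (Fin k))) : SimpleGraph V :=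
  (fromEdgeSet (E : Set (Sym2 (Fin k)))).comap corner.symm

theorem ncard_neighborSet_cornerGraph (hE : E ∈ forestEdgeSets f) (c : Fin k) :
    ((cornerGraph corner E).neighborSet (corner c)).ncard = Finset.card {d | s(c, d) ∈ E} := by
  have hadj (d : Fin k) : (cornerGraph corner E).Adj (corner c) (corner d) ↔ s(c, d) ∈ E := by
    rw [cornerGraph, SimpleGraph.comap_adj, corner.symm_apply_apply, corner.symm_apply_apply,
      ← mem_edgeSet, edgeSet_fromEdgeSet_of_subset (subset_of_mem_forestEdgeSets hE),
      Finset.mem_coe]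
  rw [← Set.ncard_coe_finset, ← Set.ncard_image_of_injective _ corner.injective]
  congr 1
  ext v
  obtain ⟨d, rfl⟩ := corner.surjective v
  simp [hadj]

theorem injOn_cornerGraph :
    Set.InjOn (cornerGraph corner) (forestEdgeSets f : Set (Finset (Sym2 (Fin k)))) := by
  intro E hE F hF hEF
  have h := congrArg edgeSet (corner.simpleGraph.injective hEF)
  rwa [edgeSet_fromEdgeSet_of_subset (subset_of_mem_forestEdgeSets hE),
    edgeSet_fromEdgeSet_of_subset (subset_of_mem_forestEdgeSets hF), Finset.coe_inj] at h

theorem rootedForests_top (corner : Fin k ≃ V) (f : Labeling k) :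
    rootedForests ⊤ corner f.partition = cornerGraph corner '' forestEdgeSets f := by
  classical
  have hcomap {T : SimpleGraph (Fin k)} :
      T.comap corner.symm ∈ rootedForests ⊤ corner f.partition ↔
        T ∈ rootedForests ⊤ id f.partition := by
    have h := comap_mem_rootedForests_iff (T := T) (H := ⊤) (corner := corner)
      (r := f.partition) corner.symm
    rwa [comap_top corner.symm.injective, corner.symm_comp_self] at h
  refine Set.Subset.antisymm (fun S hS => ?_) (Set.image_subset_iff.2 fun E hE => ?_)
  · obtain ⟨T, rfl⟩ := corner.simpleGraph.surjective S
    have hT : fromEdgeSet (T.edgeFinset : Set (Sym2 (Fin k))) = T := by simp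
    refine ⟨T.edgeFinset, ?_, congrArg (SimpleGraph.comap corner.symm) hT⟩
    exact (fromEdgeSet_mem_rootedForests_iff (edgeFinset_mono le_top)).1
      (hT.symm ▸ hcomap.1 hS)
  · exact hcomap.2 ((fromEdgeSet_mem_rootedForests_iff (subset_of_mem_forestEdgeSets hE)).2 hE)

theorem forestCount_top (corner : Fin k ≃ V) (f : Labeling k) :
    forestCount ⊤ corner f = (forestEdgeSets f).card := by
  rw [forestCount, rootedForests_top, injOn_cornerGraph.ncard_image, Set.ncard_coe_finset]

theorem degreeCount_top (corner : Fin k ≃ V) (f : Labeling k) (c : Fin k) (d : ℕ) :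
    degreeCount ⊤ corner f c d =
      Finset.card {E ∈ forestEdgeSets f | Finset.card {e | s(c, e) ∈ E} = d} := by
  have hinj : Set.InjOn (cornerGraph corner)
      {E ∈ forestEdgeSets f | Finset.card {e | s(c, e) ∈ E} = d} :=
    injOn_cornerGraph.mono fun E hE => hE.1
  rw [degreeCount, rootedForests_top, ← Set.ncard_coe_finset, Finset.coe_filter, ← hinj.ncard_image]
  congr 1
  ext T
  constructor
  · rintro ⟨⟨E, hE, rfl⟩, hd⟩
    exact ⟨E, ⟨hE, ncard_neighborSet_cornerGraph hE c ▸ hd⟩, rfl⟩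
  · rintro ⟨E, ⟨hE, hd⟩, rfl⟩
    exact ⟨⟨E, hE, rfl⟩, (ncard_neighborSet_cornerGraph hE c).trans hd⟩

end CompleteGraph

section Gasket

variable {n : ℕ}

theorem shift_injective (t : ℕ × ℕ) : Function.Injective (shift t) := by
  rintro ⟨x, y⟩ ⟨x', y'⟩ h
  simpa [shift] using h

theorem shift_comm (s t : ℕ × ℕ) : shift s t = shift t s := by
  simp [shift, add_comm]

theorem shift_zero : shift (0, 0) = id := by
  funext p
  simp [shift]

/-- The outmost vertices of `SG n`, numbered in the order `o`, `a`, `b`. They are also the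
translation vectors of the three copies of `SG n` in `SG (n + 1)`. -/
def corner (n : ℕ) : Fin 3 → Vert n := ![o n, a n, b n]

theorem corner_injective (n : ℕ) : Function.Injective (corner n) := by
  have hn : (0 : ℕ) ≠ 2 ^ n := by positivity
  intro c d hcd
  have := congrArg Subtype.val hcd
  fin_cases c <;> fin_cases d <;> simp [corner, o, a, b, hn] at this ⊢

theorem shift_corner_self (n : ℕ) (c : Fin 3) :
    shift (corner n c) (corner n c) = corner (n + 1) c := by
  fin_cases c <;> simp [corner, o, a, b, shift, pow_succ, mul_two]

theorem verts_succ (n : ℕ) :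
    verts (n + 1) = Finset.univ.biUnion fun i => (verts n).image (shift (corner n i)) := by
  ext p
  simp [verts, corner, o, a, b, shift_zero, Fin.exists_fin_succ, -Prod.exists]

theorem edges_succ (n : ℕ) : edges (n + 1) =
    Finset.univ.biUnion fun i => (edges n).image (Sym2.map (shift (corner n i))) := by
  ext e
  simp [edges, corner, o, a, b, shift_zero, Fin.exists_fin_succ]

theorem mem_verts_succ {p : ℕ × ℕ} :
    p ∈ verts (n + 1) ↔ ∃ i, ∃ v ∈ verts n, shift (corner n i) v = p := by
  simp [verts_succ]

theorem add_le_of_mem_verts {p : ℕ × ℕ} (hp : p ∈ verts n) : p.1 + p.2 ≤ 2 ^ n := by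
  induction n generalizing p with
  | zero =>
    simp only [verts, Finset.mem_insert, Finset.mem_singleton] at hp
    rcases hp with rfl | rfl | rfl <;> simp
  | succ n ih =>
    obtain ⟨i, v, hv, rfl⟩ := mem_verts_succ.1 hp
    have := ih hv
    fin_cases i <;> simp [shift, corner, o, a, b, pow_succ] <;> omega

theorem eq_corner_of_shift_eq {i j : Fin 3} {u v : Vert n} (hij : i ≠ j)
    (h : shift (corner n i) u = shift (corner n j) v) : u = corner n j := by
  obtain ⟨⟨x, y⟩, hu⟩ := u
  obtain ⟨⟨x', y'⟩, hv⟩ := v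
  have := add_le_of_mem_verts hu
  have := add_le_of_mem_verts hv
  fin_cases i <;> fin_cases j <;> simp_all [shift, corner, o, a, b] <;> omega

/-- `SG (n + 1)` as three copies of `SG n`. -/
def gasketGluing (n : ℕ) : Gluing (Fin 3) (Vert n) (Vert (n + 1)) where
  corner := ⟨corner n, corner_injective n⟩
  copy i := ⟨fun v => ⟨shift (corner n i) v, mem_verts_succ.2 ⟨i, v, v.2, rfl⟩⟩,
    fun _ _ h => Subtype.ext (shift_injective _ (congrArg Subtype.val h))⟩
  copy_corner_comm _ _ := Subtype.ext (shift_comm _ _)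
  eq_corner_of_copy_eq hij h := eq_corner_of_shift_eq hij (congrArg Subtype.val h)
  exists_copy_eq w :=
    let ⟨i, v, hv, h⟩ := mem_verts_succ.1 w.2
    ⟨i, ⟨v, hv⟩, Subtype.ext h⟩

theorem gasketGluing_junction_diag (n : ℕ) :
    (gasketGluing n).junction ∘ Sym2.diag = corner (n + 1) :=
  funext fun c => Subtype.ext (shift_corner_self n c)

theorem mem_verts_of_mem_edges {e : Sym2 (ℕ × ℕ)} {p : ℕ × ℕ} (he : e ∈ edges n) (hp : p ∈ e) :
    p ∈ verts n := by
  induction n generalizing e p with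
  | zero =>
    simp only [edges, Finset.mem_insert, Finset.mem_singleton] at he
    rcases he with rfl | rfl | rfl <;> rcases Sym2.mem_iff.1 hp with rfl | rfl <;> simp [verts]
  | succ n ih =>
    simp only [edges_succ, Finset.mem_biUnion, Finset.mem_image] at he
    obtain ⟨i, -, e, he, rfl⟩ := he
    obtain ⟨v, hv, rfl⟩ := Sym2.mem_map.1 hp
    exact mem_verts_succ.2 ⟨i, v, ih he hv, rfl⟩

theorem SG_adj {x y : Vert n} : (SG n).Adj x y ↔ s(x.1, y.1) ∈ edges n ∧ x ≠ y := by
  simp only [SG, comap_adj, fromEdgeSet_adj, Finset.mem_coe, ne_eq, Subtype.coe_inj]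

theorem SG_succ (n : ℕ) : SG (n + 1) = (gasketGluing n).glue fun _ => SG n := by
  ext x y
  simp only [Gluing.glue_adj, SG_adj, edges_succ, Finset.mem_biUnion, Finset.mem_univ, true_and,
    Finset.mem_image]
  constructor
  · rintro ⟨⟨i, e, he, hxy⟩, hne⟩
    induction e with | _ p q
    have hp := mem_verts_of_mem_edges he (Sym2.mem_mk_left p q)
    have hq := mem_verts_of_mem_edges he (Sym2.mem_mk_right p q)
    rcases Sym2.eq_iff.1 hxy with ⟨hx, hy⟩ | ⟨hx, hy⟩
    · refine ⟨i, ⟨p, hp⟩, ⟨q, hq⟩, ⟨he, ?_⟩, Subtype.ext hx, Subtype.ext hy⟩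
      rintro ⟨⟩
      exact hne (Subtype.ext (hx.symm.trans hy))
    · refine ⟨i, ⟨q, hq⟩, ⟨p, hp⟩, ⟨Sym2.eq_swap ▸ he, ?_⟩, Subtype.ext hy, Subtype.ext hx⟩
      rintro ⟨⟩
      exact hne (Subtype.ext (hy.symm.trans hx))
  · rintro ⟨i, u, v, ⟨he, hne⟩, rfl, rfl⟩
    exact ⟨⟨i, _, he, rfl⟩, ((gasketGluing n).copy i).injective.ne hne⟩

theorem corner_zero_surjective : Function.Surjective (corner 0) := by decide

theorem SG_zero : SG 0 = ⊤ := by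
  ext x y
  obtain ⟨c, rfl⟩ := corner_zero_surjective x
  obtain ⟨d, rfl⟩ := corner_zero_surjective y
  rw [SG_adj, top_adj]
  revert c d
  decide

end Gasket

section Recursion

/-- How the corner `c` is connected to the other two corners: all three corners are joined (`0`),
only the other two are (`1`), `c` is joined with exactly one of them (`2`), or the three corners are
separated (`3`). -/
def state (c : Fin 3) (f : Labeling 3) : Fin 4 :=
  if ∃ d, d ≠ c ∧ f.1 d = f.1 c then (if f.blocks = 1 then 0 else 2)
  else if f.blocks = 2 then 1 else 3

/-- The number of rooted forests of `SG n` inducing the partition `f` of the corners is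
`N * t ^ f.blocks * multiplicity f` for some `N` and `t` that depend on `n` only. The factor `3`
comes from the relation `τ n * h n = 3 * g n ^ 2`, where `τ n` is the number of spanning trees. -/
def multiplicity (f : Labeling 3) : ℕ := if f.blocks = 3 then 3 else 1

/-- The entry `(s, s')` is the weighted number of ways to obtain the state `s` of an outer corner by
gluing three forests, the one at this corner being in the state `s'`. -/
def gluingMatrix : Matrix (Fin 4) (Fin 4) ℕ :=
  !![4, 0, 2, 0; 1, 4, 2, 3; 6, 0, 4, 0; 12, 12, 14, 12]

set_option maxRecDepth 100000 in
theorem sum_prod_multiplicity (c : Fin 3) (f' : Labeling 3) (s : Fin 4) :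
    ∑ f : Fin 3 → Labeling 3 with
        Glues (fun i => (f i).partition) f'.partition ∧ state c (f c) = s,
      ∏ i, multiplicity (f i) = gluingMatrix (state c f') s := by
  revert c f' s
  decide +kernel

theorem mul_sum_gluingMatrix (c : Fin 3) (f : Labeling 3) :
    5 * 3 ^ f.blocks * ∑ s, gluingMatrix (state c f) s = 18 * 5 ^ f.blocks * multiplicity f := by
  revert c f
  decide +kernel

theorem sum_gluingMatrix (c : Fin 3) (f : Labeling 3) :
    ∑ s, (gluingMatrix (state c f) s : ℝ) = 18 / 5 * (5 / 3) ^ f.blocks * multiplicity f := by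
  have h : 5 * 3 ^ f.blocks * ∑ s, (gluingMatrix (state c f) s : ℝ) =
    18 * 5 ^ f.blocks * multiplicity f := mod_cast mul_sum_gluingMatrix c f
  rw [div_pow]
  field_simp
  linarith

theorem sum_glues (φ : Fin 4 → ℝ) (c : Fin 3) (f' : Labeling 3) :
    ∑ f : Fin 3 → Labeling 3 with Glues (fun i => (f i).partition) f'.partition,
        φ (state c (f c)) * ∏ i, (multiplicity (f i) : ℝ) =
      ∑ s, gluingMatrix (state c f') s * φ s := by
  rw [← Finset.sum_fiberwise _ fun f => state c (f c)]
  refine Finset.sum_congr rfl fun s _ => ?_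
  rw [Finset.filter_filter, ← sum_prod_multiplicity, Nat.cast_sum, Finset.sum_mul]
  refine Finset.sum_congr rfl fun f hf => ?_
  rw [(Finset.mem_filter.1 hf).2.2, Nat.cast_prod, mul_comm]

/-- The probability that a corner in a given state has degree `d` in a random rooted forest of
`SG n`. The entries for the states `1` and `3` are the probabilities `G d n (b n)` and
`H d n (o n)`; those for the states `0` and `2` are the remaining part of the solution of the
recursion `sum_gluingMatrix_mul_degreeLaw`. -/
noncomputable def degreeLaw (d : Fin 3) (n : ℕ) : Fin 4 → ℝ :=
  ![![0,
      33 / 28 * (3 / 5) ^ n - 5 / 28 * (1 / 25) ^ n,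
      0,
      11 / 14 * (3 / 5) ^ n + 3 / 14 * (1 / 25) ^ n],
    ![11 / 14 - 5 / 42 * (1 / 15) ^ n,
      11 / 14 - 2 / 7 * (1 / 15) ^ n - 6 / 7 * (3 / 5) ^ n + 5 / 14 * (1 / 25) ^ n,
      11 / 14 + 3 / 14 * (1 / 15) ^ n,
      11 / 14 + 3 / 14 * (1 / 15) ^ n - 4 / 7 * (3 / 5) ^ n - 3 / 7 * (1 / 25) ^ n],
    ![3 / 14 + 5 / 42 * (1 / 15) ^ n,
      3 / 14 + 2 / 7 * (1 / 15) ^ n - 9 / 28 * (3 / 5) ^ n - 5 / 28 * (1 / 25) ^ n,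
      3 / 14 - 3 / 14 * (1 / 15) ^ n,
      3 / 14 - 3 / 14 * (1 / 15) ^ n - 3 / 14 * (3 / 5) ^ n + 3 / 14 * (1 / 25) ^ n]] d

theorem sum_gluingMatrix_mul_degreeLaw (d : Fin 3) (n : ℕ) (s : Fin 4) :
    ∑ s', gluingMatrix s s' * degreeLaw d n s' =
      (∑ s', (gluingMatrix s s' : ℝ)) * degreeLaw d (n + 1) s := by
  fin_cases d <;> fin_cases s <;>
    simp [Fin.sum_univ_four, gluingMatrix, degreeLaw, pow_succ] <;> ring

/-- For every partition of the corners, the number of rooted forests of `H` and the distribution of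
the degrees of the corners are those of `SG n`, the former up to the scaling by `N` and `t`. -/
def HasDegreeLaw {V : Type*} (H : SimpleGraph V) (corner : Fin 3 → V) (n : ℕ) (N t : ℝ) : Prop :=
  ∀ f, forestCount H corner f = N * t ^ f.blocks * multiplicity f ∧
    ∀ c (d : Fin 3),
      degreeCount H corner f c d = forestCount H corner f * degreeLaw d n (state c f)

namespace HasDegreeLaw

variable {V W : Type*} {H : SimpleGraph V} {K : Gluing (Fin 3) V W} {n : ℕ} {N t : ℝ}
  {f : Fin 3 → Labeling 3} {f' : Labeling 3}

theorem prod_forestCount (hH : HasDegreeLaw H K.corner n N t)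
    (hf : Glues (fun i => (f i).partition) f'.partition) :
    ∏ i, (forestCount H K.corner (f i) : ℝ) =
      N ^ 3 * t ^ (f'.blocks + 3) * ∏ i, (multiplicity (f i) : ℝ) := by
  simp only [(hH _).1]
  rw [Finset.prod_mul_distrib, Finset.prod_mul_distrib, Finset.prod_pow_eq_pow_sum,
    (Labeling.glues_iff.1 hf).1, Finset.prod_const, Finset.card_univ, Fintype.card_fin]
  rfl

theorem prod_ite_degreeCount (hH : HasDegreeLaw H K.corner n N t)
    (hf : Glues (fun i => (f i).partition) f'.partition) (c d : Fin 3) :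
    ∏ i, (if i = c then (degreeCount H K.corner (f i) c d : ℝ)
        else forestCount H K.corner (f i)) =
      N ^ 3 * t ^ (f'.blocks + 3) *
        (degreeLaw d n (state c (f c)) * ∏ i, (multiplicity (f i) : ℝ)) := by
  have hfactor (i : Fin 3) : (if i = c then (degreeCount H K.corner (f i) c d : ℝ)
      else forestCount H K.corner (f i)) = forestCount H K.corner (f i) *
        if i = c then degreeLaw d n (state c (f c)) else 1 := by
    split_ifs with hi
    · rw [hi, (hH _).2]
    · rw [mul_one]
  rw [Finset.prod_congr rfl fun i _ => hfactor i, Finset.prod_mul_distrib, Finset.prod_ite_eq',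
    if_pos (Finset.mem_univ c), hH.prod_forestCount hf]
  ring

variable [Finite V]

theorem forestCount_glue (hH : HasDegreeLaw H K.corner n N t) :
    (forestCount (K.glue fun _ => H) (K.junction ∘ Sym2.diag) f' : ℝ) =
      18 / 5 * N ^ 3 * t ^ 3 * (5 / 3 * t) ^ f'.blocks * multiplicity f' := by
  have hsum := sum_glues (fun _ => 1) 0 f'
  simp only [one_mul, mul_one, sum_gluingMatrix] at hsum
  rw [SierpinskiGasket.forestCount_glue]
  push_cast
  rw [Finset.sum_congr rfl fun f hf => hH.prod_forestCount (Finset.mem_filter.1 hf).2,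
    ← Finset.mul_sum, hsum]
  ring

theorem glue (hH : HasDegreeLaw H K.corner n N t) :
    HasDegreeLaw (K.glue fun _ => H) (K.junction ∘ Sym2.diag) (n + 1)
      (18 / 5 * N ^ 3 * t ^ 3) (5 / 3 * t) := by
  refine fun f' => ⟨hH.forestCount_glue, fun c d => ?_⟩
  rw [hH.forestCount_glue, degreeCount_glue]
  push_cast
  rw [Finset.sum_congr rfl fun f hf => hH.prod_ite_degreeCount (Finset.mem_filter.1 hf).2 c d,
    ← Finset.mul_sum, sum_glues, sum_gluingMatrix_mul_degreeLaw, sum_gluingMatrix]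
  ring

end HasDegreeLaw

end Recursion

section Triangle

set_option maxRecDepth 100000 in
theorem card_forestEdgeSets (f : Labeling 3) :
    3 ^ f.blocks * (forestEdgeSets f).card = 9 * multiplicity f := by
  revert f
  decide +kernel

/-- Three times the values of `degreeLaw` at stage `0`. -/
def triangleLaw : Matrix (Fin 3) (Fin 4) ℕ :=
  !![0, 3, 0, 3; 2, 0, 3, 0; 1, 0, 0, 0]

set_option maxRecDepth 100000 in
theorem card_filter_forestEdgeSets (f : Labeling 3) (c d : Fin 3) :
    3 * Finset.card {E ∈ forestEdgeSets f | Finset.card {e | s(c, e) ∈ E} = (d : ℕ)} =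
      (forestEdgeSets f).card * triangleLaw d (state c f) := by
  revert f c d
  decide +kernel

theorem triangleLaw_eq (d : Fin 3) (s : Fin 4) : (triangleLaw d s : ℝ) = 3 * degreeLaw d 0 s := by
  fin_cases d <;> fin_cases s <;> norm_num [triangleLaw, degreeLaw]

theorem hasDegreeLaw_top {V : Type*} (corner : Fin 3 ≃ V) :
    HasDegreeLaw (⊤ : SimpleGraph V) corner 0 9 (1 / 3) := by
  refine fun f => ⟨?_, fun c d => ?_⟩
  · have h : 3 ^ f.blocks * ((forestEdgeSets f).card : ℝ) = 9 * multiplicity f :=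
      mod_cast card_forestEdgeSets f
    rw [forestCount_top, mul_right_comm, ← h, mul_right_comm, ← mul_pow]
    norm_num
  · have h : 3 * (degreeCount ⊤ corner f c d : ℝ) =
        forestCount ⊤ corner f * triangleLaw d (state c f) := by
      rw [degreeCount_top, forestCount_top]
      exact_mod_cast card_filter_forestEdgeSets f c d
    rw [triangleLaw_eq] at h
    linarith

end Triangle

section DegreeLaw

theorem exists_hasDegreeLaw (n : ℕ) :
    ∃ N t, 0 < N ∧ 0 < t ∧ HasDegreeLaw (SG n) (corner n) n N t := by
  induction n with
  | zero =>
    refine ⟨9, 1 / 3, by norm_num, by norm_num, ?_⟩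
    rw [SG_zero]
    exact hasDegreeLaw_top (Equiv.ofBijective _ ⟨corner_injective 0, corner_zero_surjective⟩)
  | succ n ih =>
    obtain ⟨N, t, hN, ht, hSG⟩ := ih
    refine ⟨18 / 5 * N ^ 3 * t ^ 3, 5 / 3 * t, by positivity, by positivity, ?_⟩
    rw [SG_succ, ← gasketGluing_junction_diag]
    exact HasDegreeLaw.glue hSG

theorem degreeCount_div_forestCount (n : ℕ) (f : Labeling 3) (c d : Fin 3) :
    (degreeCount (SG n) (corner n) f c d : ℝ) / forestCount (SG n) (corner n) f =
      degreeLaw d n (state c f) := by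
  obtain ⟨N, t, hN, ht, hSG⟩ := exists_hasDegreeLaw n
  have hmultiplicity : multiplicity f ≠ 0 := by
    unfold multiplicity
    split_ifs <;> decide
  have hcount : (forestCount (SG n) (corner n) f : ℝ) ≠ 0 := by
    rw [(hSG f).1]
    positivity
  rw [(hSG f).2, mul_div_cancel_left₀ _ hcount]

/-- The partition `{o, a} | {b}` of the corners. -/
def twoTreesLabeling : Labeling 3 := ⟨![0, 0, 2], by decide⟩

/-- The partition of the corners into three singletons. -/
def threeTreesLabeling : Labeling 3 := ⟨![0, 1, 2], by decide⟩

theorem setoid_fin_three_ext_iff {r s : Setoid (Fin 3)} :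
    r = s ↔ (r 0 1 ↔ s 0 1) ∧ (r 0 2 ↔ s 0 2) ∧ (r 1 2 ↔ s 1 2) := by
  refine ⟨?_, fun ⟨h01, h02, h12⟩ => Setoid.ext fun c d => ?_⟩
  · rintro rfl
    exact ⟨Iff.rfl, Iff.rfl, Iff.rfl⟩
  · have hlt {c d : Fin 3} (hcd : c < d) : r c d ↔ s c d := by
      fin_cases c <;> fin_cases d <;> first | exact absurd hcd (by decide) | assumption
    rcases lt_trichotomy c d with hcd | rfl | hcd
    · exact hlt hcd
    · exact iff_of_true (r.refl' c) (s.refl' c)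
    · rw [r.comm', s.comm', hlt hcd]

theorem twoTrees_eq_rootedForests (n : ℕ) :
    twoTrees n = rootedForests (SG n) (corner n) twoTreesLabeling.partition := by
  ext T
  have hblocks : twoTreesLabeling.blocks = 2 := by decide
  have hpartition : cornerPartition T (corner n) = twoTreesLabeling.partition ↔
      T.Reachable (o n) (a n) ∧ ¬ T.Reachable (o n) (b n) := by
    rw [setoid_fin_three_ext_iff]
    simpa [cornerPartition_apply, Labeling.partition_apply, twoTreesLabeling, corner]
      using fun hoa hob hab => hob (hoa.trans hab)
  rw [mem_rootedForests_iff_card_connectedComponent, Labeling.card_quotient_partition, hblocks,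
    hpartition]
  rfl

theorem threeTrees_eq_rootedForests (n : ℕ) :
    threeTrees n = rootedForests (SG n) (corner n) threeTreesLabeling.partition := by
  ext T
  have hblocks : threeTreesLabeling.blocks = 3 := by decide
  have hpartition : cornerPartition T (corner n) = threeTreesLabeling.partition ↔
      ¬ T.Reachable (o n) (a n) ∧ ¬ T.Reachable (o n) (b n) ∧ ¬ T.Reachable (a n) (b n) := by
    rw [setoid_fin_three_ext_iff]
    simp [cornerPartition_apply, Labeling.partition_apply, threeTreesLabeling, corner]
  rw [mem_rootedForests_iff_card_connectedComponent, Labeling.card_quotient_partition, hblocks,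
    hpartition]
  rfl

theorem G_top_eq (n : ℕ) (d : Fin 3) : G d n (b n) = degreeLaw d n 1 := by
  have hstate : state 2 twoTreesLabeling = 1 := by decide
  have h := degreeCount_div_forestCount n twoTreesLabeling 2 d
  rwa [hstate, degreeCount, forestCount, ← twoTrees_eq_rootedForests] at h

theorem H_origin_eq (n : ℕ) (d : Fin 3) : H d n (o n) = degreeLaw d n 3 := by
  have hstate : state 0 threeTreesLabeling = 3 := by decide
  have h := degreeCount_div_forestCount n threeTreesLabeling 0 d
  rwa [hstate, degreeCount, forestCount, ← threeTrees_eq_rootedForests] at h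

end DegreeLaw

end SierpinskiGasket

theorem mainTheorem9 (n : ℕ) :
    SierpinskiGasket.G 0 n (SierpinskiGasket.b n)
        = 33 / 28 * (3 / 5 : ℝ) ^ n - 5 / 28 * (1 / 25 : ℝ) ^ n ∧
    SierpinskiGasket.H 0 n (SierpinskiGasket.o n)
        = 11 / 14 * (3 / 5 : ℝ) ^ n + 3 / 14 * (1 / 25 : ℝ) ^ n ∧
    SierpinskiGasket.G 1 n (SierpinskiGasket.b n)
        = 11 / 14 - 2 / 7 * (1 / 15 : ℝ) ^ n - 6 / 7 * (3 / 5 : ℝ) ^ n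
          + 5 / 14 * (1 / 25 : ℝ) ^ n ∧
    SierpinskiGasket.G 2 n (SierpinskiGasket.b n)
        = 3 / 14 + 2 / 7 * (1 / 15 : ℝ) ^ n - 9 / 28 * (3 / 5 : ℝ) ^ n
          - 5 / 28 * (1 / 25 : ℝ) ^ n ∧
    SierpinskiGasket.H 1 n (SierpinskiGasket.o n)
        = 11 / 14 + 3 / 14 * (1 / 15 : ℝ) ^ n - 4 / 7 * (3 / 5 : ℝ) ^ n
          - 3 / 7 * (1 / 25 : ℝ) ^ n ∧
    SierpinskiGasket.H 2 n (SierpinskiGasket.o n)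
        = 3 / 14 - 3 / 14 * (1 / 15 : ℝ) ^ n - 3 / 14 * (3 / 5 : ℝ) ^ n
          + 3 / 14 * (1 / 25 : ℝ) ^ n := by
  have hG (d : Fin 3) := SierpinskiGasket.G_top_eq n d
  have hH (d : Fin 3) := SierpinskiGasket.H_origin_eq n d
  exact ⟨hG 0, hH 0, hG 1, hG 2, hH 1, hH 2⟩
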